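/- A digraph $H$ is called ubiquitous if every digraph $D$ that contains, for each $k \in \mathbb{N}$, a family of $k$ pairwise vertex-disjoint copies of $H$ (subdigraphs of $D$, not necessarily induced, that are isomorphic to $H$) also contains infinitely many pairwise vertex-disjoint copies of $H$. A double ray is a digraph $R$ together with a linear order on its vertex set that is isomorphic to $\mathbb{Z}$, such that any two vertices $v, w$ that are consecutive in this order are joined by exactly one of the arcs $vw$, $wv$, and there are no other arcs. A turn of $R$ is a vertex that is incident with two outgoing arcs or with two incoming arcs. Theorem. Every double ray with a finite odd number of turns is ubiquitous. -/

import Mathlib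

universe u v

/-- `IsDoubleRay R`: the digraph `R`, together with the given linear order on its vertex set, is an
(oriented) double ray. The order is isomorphic to `ℤ`; consecutive vertices are joined by an arc in
exactly one of the two directions; there are no other arcs (in particular no loops).
Here `v ⋖ w` says that `w` is the immediate successor of `v`. -/
structure IsDoubleRay {V : Type*} [LinearOrder V] (R : Digraph V) : Prop where
  orderIso_int : Nonempty (V ≃o ℤ)
  adj_of_consecutive : ∀ v w : V, v ⋖ w →
    (R.Adj v w ∧ ¬ R.Adj w v) ∨ (R.Adj w v ∧ ¬ R.Adj v w)
  not_adj_of_not_consecutive : ∀ v w : V, ¬ v ⋖ w → ¬ w ⋖ v → ¬ R.Adj v w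

/-- A turn is a vertex that is incident with two outgoing or with two incoming arcs. -/
def IsTurn {V : Type*} (R : Digraph V) (v : V) : Prop :=
  (∃ u w : V, u ≠ w ∧ R.Adj v u ∧ R.Adj v w) ∨ (∃ u w : V, u ≠ w ∧ R.Adj u v ∧ R.Adj w v)

/-- A copy of `H` in `D`: a subdigraph of `D` (not necessarily induced) with a fixed isomorphism
from `H` onto it, that is, an injective map on vertices that sends arcs to arcs. -/
structure DigraphCopy {V W : Type*} (H : Digraph V) (D : Digraph W) where
  toFun : V → W
  injective : Function.Injective toFun
  map_adj : ∀ {v w : V}, H.Adj v w → D.Adj (toFun v) (toFun w)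

/-- The vertex set of a copy. -/
def DigraphCopy.verts {V W : Type*} {H : Digraph V} {D : Digraph W} (c : DigraphCopy H D) :
    Set W :=
  Set.range c.toFun

/-- `D` contains a family, indexed by `ι`, of pairwise vertex-disjoint copies of `H`. -/
def HasDisjointCopies {V W : Type*} (ι : Type) (H : Digraph V) (D : Digraph W) : Prop :=
  ∃ c : ι → DigraphCopy H D, Pairwise fun i j => Disjoint (c i).verts (c j).verts

/-- `H` is ubiquitous: every digraph (with vertices in an arbitrary universe) that contains `k`
disjoint copies of `H` for every natural number `k` contains infinitely many disjoint copies. -/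
def Ubiquitous {V : Type u} (H : Digraph V) : Prop :=
  ∀ (W : Type v) (D : Digraph W), (∀ k : ℕ, HasDisjointCopies (Fin k) H D) →
    HasDisjointCopies ℕ H D

/-! Identify the double ray with `ℤ`. Each turn reverses the direction of the arcs, so an odd number
of turns makes the two tails both point away from the origin or both towards it; reversing all arcs,
suppose away. Rays pointing outwards can be rerouted along each other with their first vertices
fixed, which is what `exists_ray_exchange` does.

Disjoint copies are added one at a time. Given `n` copies, take more than `2 * n` new ones that
avoid the finite central parts of the old copies and whose middle parts avoid the old copies
altogether. Rerouting the `2 * n` old tails along the new tails makes them meet at most `2 * n` of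
these, so some new copy is missed and can be added (`exists_disjointFamily_succ`). The central parts
kept fixed grow, so the families converge.

Enough new middle parts must stay free. The invariant is that the current copies meet less than half
of the middle parts of the `k`-th given family, for ultrafilter-almost all `k`. As disjoint sets
share boundedly many middle vertices per copy, only boundedly many of them can meet a fixed
proportion of middles, so new copies of small cost exist (`exists_avoiding_family`). -/

open Filter

/-! ### Exchange of rays -/

/-- In the exchange procedure with current positions `s`, the ray `Q i` stays where it is if it
stands on some `T j` and no ray has met `T j` further along. -/
def RayHeld {W I J : Type*} (Q : I → ℕ → W) (T : J → ℕ → W) (s : I → ℕ) (i : I) : Prop :=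
  ∃ j t, Q i (s i) = T j t ∧ ∀ i' k' t', k' ≤ s i' → Q i' k' = T j t' → t' ≤ t

open Classical in
/-- The position of each ray after `n` rounds of the exchange procedure. -/
noncomputable def rayPos {W I J : Type*} (Q : I → ℕ → W) (T : J → ℕ → W) : ℕ → I → ℕ
  | 0 => fun _ => 0
  | n + 1 => fun i => if RayHeld Q T (rayPos Q T n) i then rayPos Q T n i else rayPos Q T n i + 1

theorem rayPos_of_held {W I J : Type*} {Q : I → ℕ → W} {T : J → ℕ → W} {n : ℕ} {i : I}
    (h : RayHeld Q T (rayPos Q T n) i) : rayPos Q T (n + 1) i = rayPos Q T n i := by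
  simp [rayPos, h]

theorem rayPos_of_not_held {W I J : Type*} {Q : I → ℕ → W} {T : J → ℕ → W} {n : ℕ} {i : I}
    (h : ¬ RayHeld Q T (rayPos Q T n) i) : rayPos Q T (n + 1) i = rayPos Q T n i + 1 := by
  simp [rayPos, h]

theorem rayPos_succ_le {W I J : Type*} (Q : I → ℕ → W) (T : J → ℕ → W) (n : ℕ) (i : I) :
    rayPos Q T n i ≤ rayPos Q T (n + 1) i ∧ rayPos Q T (n + 1) i ≤ rayPos Q T n i + 1 := by
  by_cases h : RayHeld Q T (rayPos Q T n) i
  · rw [rayPos_of_held h]; omega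
  · rw [rayPos_of_not_held h]; omega

theorem rayPos_mono {W I J : Type*} (Q : I → ℕ → W) (T : J → ℕ → W) (i : I) :
    Monotone fun n => rayPos Q T n i :=
  monotone_nat_of_le_succ fun n => (rayPos_succ_le Q T n i).1

/-- At every round, the furthest meeting point on a `T j` that has been met is occupied. -/
theorem exists_furthest_rayPos {W I J : Type*} [Finite I] {Q : I → ℕ → W} {T : J → ℕ → W}
    (hT : Function.Injective fun x : J × ℕ => T x.1 x.2) (n : ℕ) (j : J)
    (h : ∃ i k t, k ≤ rayPos Q T n i ∧ Q i k = T j t) :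
    ∃ i₀ t₀, Q i₀ (rayPos Q T n i₀) = T j t₀ ∧
      ∀ i k t, k ≤ rayPos Q T n i → Q i k = T j t → t ≤ t₀ := by
  have key : ∀ m, (∃ i t, Q i (rayPos Q T m i) = T j t) →
      ∃ i₀ t₀, Q i₀ (rayPos Q T m i₀) = T j t₀ ∧
        ∀ i t, Q i (rayPos Q T m i) = T j t → t ≤ t₀ := by
    rintro m ⟨i, t, hit⟩
    have hfin : {t | ∃ i, Q i (rayPos Q T m i) = T j t}.Finite := by
      have : {t | ∃ i, Q i (rayPos Q T m i) = T j t} =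
          ⋃ i, {t | Q i (rayPos Q T m i) = T j t} := by ext; simp
      rw [this]
      refine Set.finite_iUnion fun i => Set.Subsingleton.finite ?_
      intro a ha b hb
      have : ((j, a) : J × ℕ) = (j, b) := hT (by
        change T j a = T j b
        rw [← show _ = T j a from ha, ← show _ = T j b from hb])
      exact (Prod.ext_iff.1 this).2
    obtain ⟨t₀, ⟨i₀, h₀⟩, hmax⟩ := Set.exists_max_image _ id hfin ⟨t, i, hit⟩
    exact ⟨i₀, t₀, h₀, fun i t h => hmax t ⟨i, h⟩⟩
  induction n with
  | zero =>
    obtain ⟨i, k, t, hk, hit⟩ := h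
    simp only [rayPos, Nat.le_zero] at hk
    subst hk
    obtain ⟨i₀, t₀, h₀, hmax⟩ := key 0 ⟨i, t, hit⟩
    refine ⟨i₀, t₀, h₀, fun i k t hk hit => ?_⟩
    simp only [rayPos, Nat.le_zero] at hk
    subst hk
    exact hmax i t hit
  | succ n ih =>
    by_cases h' : ∃ i k t, k ≤ rayPos Q T n i ∧ Q i k = T j t
    · obtain ⟨i₁, t₁, h₁, hmax₁⟩ := ih h'
      -- The ray at the furthest meeting point does not move in this round, so `T j` stays occupied.
      have hheld : RayHeld Q T (rayPos Q T n) i₁ := ⟨j, t₁, h₁, hmax₁⟩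
      have h₁' := h₁
      rw [← rayPos_of_held hheld] at h₁'
      obtain ⟨i₀, t₀, h₀, hmax⟩ := key (n + 1) ⟨i₁, t₁, h₁'⟩
      refine ⟨i₀, t₀, h₀, fun i k t hk hit => ?_⟩
      rcases le_or_gt k (rayPos Q T n i) with hk' | hk'
      · exact (hmax₁ i k t hk' hit).trans (hmax _ _ h₁')
      · have := rayPos_succ_le Q T n i
        obtain rfl : k = rayPos Q T (n + 1) i := by omega
        exact hmax i t hit
    · have hnew : ∀ i k t, k ≤ rayPos Q T (n + 1) i → Q i k = T j t →
          k = rayPos Q T (n + 1) i := by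
        intro i k t hk hit
        have := rayPos_succ_le Q T n i
        by_contra hne
        exact h' ⟨i, k, t, by omega, hit⟩
      obtain ⟨i, k, t, hk, hit⟩ := h
      obtain rfl := hnew i k t hk hit
      obtain ⟨i₀, t₀, h₀, hmax⟩ := key (n + 1) ⟨i, t, hit⟩
      refine ⟨i₀, t₀, h₀, fun i k t hk hit => ?_⟩
      obtain rfl := hnew i k t hk hit
      exact hmax i t hit

/-- Exchange of rays: finitely many disjoint rays `Q i` can be rerouted along disjoint rays `T j`,
keeping their first vertices, so that they meet at most as many of the `T j` as there are `Q i`. -/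
theorem exists_ray_exchange {W I J : Type*} [Fintype I] {D : W → W → Prop}
    {Q : I → ℕ → W} {T : J → ℕ → W}
    (hQ : Function.Injective fun x : I × ℕ => Q x.1 x.2)
    (hT : Function.Injective fun x : J × ℕ => T x.1 x.2)
    (hQD : ∀ i n, D (Q i n) (Q i (n + 1))) (hTD : ∀ j n, D (T j n) (T j (n + 1))) :
    ∃ q : I → ℕ → W, (Function.Injective fun x : I × ℕ => q x.1 x.2) ∧
      (∀ i n, D (q i n) (q i (n + 1))) ∧ (∀ i, q i 0 = Q i 0) ∧
      (∀ i n, q i n = Q i n ∨ ∃ j t, q i n = T j t) ∧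
      ∀ s : Finset J, (∀ j ∈ s, ∃ i n t, q i n = T j t) → s.card ≤ Fintype.card I := by
  classical
  let reached : I → ℕ → Prop := fun i k => ∃ n, k ≤ rayPos Q T n i
  -- The last meeting on `T j` over the whole procedure: from here a ray may safely follow `T j`.
  let dom : I → ℕ → J → ℕ → Prop := fun i k j t =>
    reached i k ∧ Q i k = T j t ∧ ∀ i' k' t', reached i' k' → Q i' k' = T j t' → t' ≤ t
  have hTinj : ∀ {j j' t t'}, T j t = T j' t' → j = j' ∧ t = t' := fun {j j' t t'} h =>
    Prod.ext_iff.1 (@hT (j, t) (j', t') h)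
  have hQinj : ∀ {j j' t t'}, Q j t = Q j' t' → j = j' ∧ t = t' := fun {j j' t t'} h =>
    Prod.ext_iff.1 (@hQ (j, t) (j', t') h)
  -- A ray moves on infinitely often, or is held forever at a point that no later meeting surpasses.
  have hcase : ∀ i, (∀ k, reached i k) ∨ ∃ k j t, dom i k j t := by
    intro i
    by_cases hst : ∃ n, ∀ m ≥ n, RayHeld Q T (rayPos Q T m) i
    · right
      obtain ⟨n, hn⟩ := hst
      have hconst : ∀ m ≥ n, rayPos Q T m i = rayPos Q T n i := by
        intro m hm
        induction m, hm using Nat.le_induction with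
        | base => rfl
        | succ m hm ih => rw [rayPos_of_held (hn m hm), ih]
      obtain ⟨j, t, hjt, -⟩ := hn n le_rfl
      refine ⟨rayPos Q T n i, j, t, ⟨n, le_rfl⟩, hjt, ?_⟩
      rintro i' k' t' ⟨m, hm⟩ hit
      obtain ⟨j₂, t₂, hjt₂, hmax⟩ := hn (max n m) (le_max_left _ _)
      rw [hconst _ (le_max_left _ _), hjt] at hjt₂
      obtain ⟨rfl, rfl⟩ := hTinj hjt₂
      exact hmax i' k' t' (hm.trans (rayPos_mono Q T i' (le_max_right n m))) hit
    · left
      push Not at hst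
      intro k
      induction k with
      | zero => exact ⟨0, Nat.zero_le _⟩
      | succ k ih =>
        obtain ⟨n, hn⟩ := ih
        obtain ⟨m, hm, hnot⟩ := hst n
        refine ⟨m + 1, ?_⟩
        rw [rayPos_of_not_held hnot]
        have : rayPos Q T n i ≤ rayPos Q T m i := rayPos_mono Q T i hm
        omega
  have hq : ∀ i, ∃ q : ℕ → W, q 0 = Q i 0 ∧ (∀ n, D (q n) (q (n + 1))) ∧
      ∀ n, (reached i n ∧ q n = Q i n) ∨
        ∃ j k t, dom i k j t ∧ k < n ∧ q n = T j (t + (n - k)) := by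
    intro i
    rcases hcase i with h | ⟨k, j, t, h⟩
    · exact ⟨Q i, rfl, hQD i, fun n => Or.inl ⟨h n, rfl⟩⟩
    · refine ⟨fun n => if n ≤ k then Q i n else T j (t + (n - k)), by simp, fun n => ?_,
        fun n => ?_⟩
      · rcases lt_trichotomy n k with hn | rfl | hn
        · simp only [hn.le, if_true, show n + 1 ≤ k from hn]
          exact hQD i n
        · simp only [le_refl, if_true, show ¬ n + 1 ≤ n by omega, if_false]
          rw [h.2.1, show n + 1 - n = 1 by omega]
          exact hTD j t
        · simp only [show ¬ n ≤ k by omega, show ¬ n + 1 ≤ k by omega, if_false]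
          rw [show t + (n + 1 - k) = t + (n - k) + 1 by omega]
          exact hTD j _
      · by_cases hn : n ≤ k
        · left
          obtain ⟨m, hm⟩ := h.1
          exact ⟨⟨m, hn.trans hm⟩, by simp [hn]⟩
        · exact Or.inr ⟨j, k, t, h, by omega, by simp [hn]⟩
  choose q hq0 hqD hqc using hq
  have hmixed : ∀ i n j k t i' (n' : ℕ), reached i n → dom i' k j t → k < n' →
      Q i n ≠ T j (t + (n' - k)) := by
    intro i n j k t i' n' hr hd hk he
    have := hd.2.2 i n _ hr he
    omega
  have hmet : ∀ i n j t, q i n = T j t → ∃ i' k' t', reached i' k' ∧ Q i' k' = T j t' := by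
    intro i n j t he
    rcases hqc i n with ⟨hr, h1⟩ | ⟨j', k, t', hd, hk, h1⟩
    · exact ⟨i, n, t, hr, h1 ▸ he⟩
    · obtain ⟨rfl, -⟩ := hTinj (h1.symm.trans he)
      exact ⟨i, k, t', hd.1, hd.2.1⟩
  refine ⟨q, ?_, hqD, hq0, fun i n => ?_, fun s hs => ?_⟩
  · rintro ⟨i, n⟩ ⟨i', n'⟩ he
    change q i n = q i' n' at he
    rcases hqc i n with ⟨hr, h1⟩ | ⟨j, k, t, hd, hk, h1⟩ <;>
      rcases hqc i' n' with ⟨hr', h1'⟩ | ⟨j', k', t', hd', hk', h1'⟩ <;> rw [h1, h1'] at he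
    · exact hQ he
    · exact absurd he (hmixed _ _ _ _ _ _ _ hr hd' hk')
    · exact absurd he.symm (hmixed _ _ _ _ _ _ _ hr' hd hk)
    -- Two rays that switch to the same `T j` both do so at its last meeting point, hence are equal.
    · obtain ⟨rfl, ht⟩ := hTinj he
      have h2 := hd.2.2 i' k' t' hd'.1 hd'.2.1
      have h3 := hd'.2.2 i k t hd.1 hd.2.1
      obtain rfl : t = t' := by omega
      obtain ⟨rfl, rfl⟩ := hQinj (hd.2.1.trans hd'.2.1.symm)
      exact Prod.ext rfl (by simp only; omega)
  · rcases hqc i n with ⟨-, h1⟩ | ⟨j, k, t, -, -, h1⟩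
    · exact Or.inl h1
    · exact Or.inr ⟨j, _, h1⟩
  · have hstage : ∀ j ∈ s, ∃ n, ∃ i k t, k ≤ rayPos Q T n i ∧ Q i k = T j t := by
      intro j hj
      obtain ⟨i, n, t, he⟩ := hs j hj
      obtain ⟨i', k', t', ⟨m, hm⟩, h⟩ := hmet i n j t he
      exact ⟨m, i', k', t', hm, h⟩
    choose! st hst using hstage
    -- At one common round every met `T j` carries a ray, and a ray stands on only one `T j` at a
    -- time.
    have hocc : ∀ j ∈ s, ∃ i t, Q i (rayPos Q T (s.sup st) i) = T j t := by
      intro j hj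
      obtain ⟨i, k, t, hk, h⟩ := hst j hj
      obtain ⟨i₀, t₀, h₀, -⟩ := exists_furthest_rayPos hT (s.sup st) j
        ⟨i, k, t, hk.trans (rayPos_mono Q T i (Finset.le_sup hj)), h⟩
      exact ⟨i₀, t₀, h₀⟩
    rcases s.eq_empty_or_nonempty with rfl | ⟨j₀, hj₀⟩
    · simp
    have : Nonempty I := ⟨(hocc j₀ hj₀).choose⟩
    choose! f t hf using hocc
    rw [← Finset.card_univ]
    refine Finset.card_le_card_of_injOn f (fun _ _ => Finset.mem_coe.2 (Finset.mem_univ _)) ?_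
    intro j hj j' hj' he
    have h1 := hf j hj
    rw [he, hf j' hj'] at h1
    exact (hTinj h1).1.symm

/-! ### Proportion of middle parts met by a set -/

open Classical in
/-- The number of members of the `k`-th family whose middle part, the image of the open interval
`(-L, L)`, meets `Y`. -/
noncomputable def middleHits {W : Type*} (c : ∀ k : ℕ, Fin k → ℤ → W) (L : ℤ) (Y : Set W)
    (k : ℕ) : ℕ :=
  (Finset.univ.filter fun j : Fin k => ∃ z ∈ Finset.Ioo (-L) L, c k j z ∈ Y).card

/-- `Y` meets at most an `ε` proportion of the middle parts of the `k`-th family, for almost all `k`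
with respect to a fixed nonprincipal ultrafilter. -/
def MeetsFewMiddles {W : Type*} (c : ∀ k : ℕ, Fin k → ℤ → W) (L : ℤ) (Y : Set W) (ε : ℝ) : Prop :=
  ∀ᶠ k in (hyperfilter ℕ : Filter ℕ), (middleHits c L Y k : ℝ) ≤ ε * k

section
variable {W : Type*} {c : ∀ k : ℕ, Fin k → ℤ → W} {L : ℤ}

theorem MeetsFewMiddles.mono {Y Z : Set W} {ε : ℝ} (h : MeetsFewMiddles c L Z ε) (hYZ : Y ⊆ Z) :
    MeetsFewMiddles c L Y ε := by
  filter_upwards [h] with k hk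
  refine le_trans ?_ hk
  norm_cast
  refine Finset.card_le_card fun j => ?_
  simp only [Finset.mem_filter, Finset.mem_univ, true_and]
  rintro ⟨z, hz, h⟩
  exact ⟨z, hz, hYZ h⟩

theorem meetsFewMiddles_empty : MeetsFewMiddles c L (∅ : Set W) 0 := by
  refine Eventually.of_forall fun k => ?_
  simp [middleHits]

theorem MeetsFewMiddles.union {Y Z : Set W} {ε δ : ℝ} (hY : MeetsFewMiddles c L Y ε)
    (hZ : MeetsFewMiddles c L Z δ) : MeetsFewMiddles c L (Y ∪ Z) (ε + δ) := by
  classical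
  filter_upwards [hY, hZ] with k h1 h2
  have : middleHits c L (Y ∪ Z) k ≤ middleHits c L Y k + middleHits c L Z k := by
    refine le_trans (Finset.card_le_card fun j => ?_) (Finset.card_union_le _ _)
    simp only [Finset.mem_filter, Finset.mem_univ, true_and, Finset.mem_union]
    rintro ⟨z, hz, h | h⟩
    · exact Or.inl ⟨z, hz, h⟩
    · exact Or.inr ⟨z, hz, h⟩
  have h3 : (middleHits c L (Y ∪ Z) k : ℝ) ≤ middleHits c L Y k + middleHits c L Z k := by
    exact_mod_cast this
  linarith

theorem MeetsFewMiddles.iUnion_fin {δ : ℝ} {m : ℕ} {Y : Fin m → Set W}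
    (h : ∀ s, MeetsFewMiddles c L (Y s) δ) : MeetsFewMiddles c L (⋃ s, Y s) (m * δ) := by
  induction m with
  | zero => simpa using meetsFewMiddles_empty
  | succ m ih =>
    have h1 := (ih (Y := fun s => Y s.castSucc) fun s => h _).union (h (Fin.last m))
    rw [show ((m + 1 : ℕ) : ℝ) * δ = m * δ + δ by push_cast; ring]
    refine h1.mono (Set.iUnion_subset fun s => ?_)
    refine Fin.lastCases Set.subset_union_right (fun s => ?_) s
    exact (Set.subset_iUnion (fun s : Fin m => Y s.castSucc) s).trans Set.subset_union_left

/-- Only boundedly many of a family of disjoint sets meet more than an `ε` proportion of the middle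
parts. -/
theorem card_mul_le_of_not_meetsFewMiddles {ι : Type*} {Y : ι → Set W}
    (hY : Pairwise fun i j => Disjoint (Y i) (Y j)) {ε : ℝ} (S : Finset ι)
    (hS : ∀ s ∈ S, ¬ MeetsFewMiddles c L (Y s) ε) :
    S.card * ε ≤ (Finset.Ioo (-L) L).card := by
  classical
  -- For an ultrafilter, failing to meet few middles means meeting many for almost all `k`; hence
  -- one `k` serves all of `S`.
  have h1 : ∀ᶠ k in (hyperfilter ℕ : Filter ℕ), ∀ s ∈ S, ε * k < (middleHits c L (Y s) k : ℝ) := by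
    rw [eventually_all_finset]
    intro s hs
    have := Ultrafilter.eventually_not.2 (hS s hs)
    filter_upwards [this] with k hk
    exact not_le.1 hk
  have h2 : ∀ᶠ k in (hyperfilter ℕ : Filter ℕ), 0 < k :=
    (eventually_gt_atTop 0).filter_mono Nat.hyperfilter_le_atTop
  obtain ⟨k, h1, h2⟩ := (h1.and h2).exists
  -- Double counting: each vertex of a middle part lies in at most one of the disjoint sets.
  have h3 : ∑ s ∈ S, middleHits c L (Y s) k ≤ k * (Finset.Ioo (-L) L).card := by
    have := Finset.sum_card_bipartiteAbove_eq_sum_card_bipartiteBelow (s := S)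
      (t := (Finset.univ : Finset (Fin k)))
      (fun s j => ∃ z ∈ Finset.Ioo (-L) L, c k j z ∈ Y s)
    simp only [Finset.bipartiteAbove, Finset.bipartiteBelow] at this
    unfold middleHits
    rw [this]
    refine (Finset.sum_le_card_nsmul _ _ (Finset.Ioo (-L) L).card fun j _ => ?_).trans (by simp)
    have hex : ∀ s ∈ S.filter (fun s => ∃ z ∈ Finset.Ioo (-L) L, c k j z ∈ Y s),
        ∃ z, z ∈ Finset.Ioo (-L) L ∧ c k j z ∈ Y s := fun s hs => (Finset.mem_filter.1 hs).2
    choose! g hg using hex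
    refine Finset.card_le_card_of_injOn g (fun s hs => (hg s hs).1) fun s hs t ht he => ?_
    by_contra hne
    have h4 := (hg t ht).2
    rw [← he] at h4
    exact Set.disjoint_left.1 (hY hne) (hg s hs).2 h4
  have h4 : (S.card : ℝ) * (ε * k) ≤ ∑ s ∈ S, (middleHits c L (Y s) k : ℝ) := by
    rw [← nsmul_eq_mul]
    exact Finset.card_nsmul_le_sum _ _ _ fun s hs => (h1 s hs).le
  have h5 : ∑ s ∈ S, (middleHits c L (Y s) k : ℝ) ≤ k * (Finset.Ioo (-L) L).card := by
    exact_mod_cast h3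
  have hk : (0 : ℝ) < k := by exact_mod_cast h2
  refine le_of_mul_le_mul_right ?_ hk
  linarith

end

/-! ### Patterns with outward tails and the extension step -/

/-- A pattern of arcs on `ℤ`, joining only consecutive integers, in which all arcs outside
`(-L, L)` point away from the origin. -/
structure TwoOutTails (S : ℤ → ℤ → Prop) (L : ℕ) : Prop where
  pos : 0 < L
  near : ∀ {z w}, S z w → w = z + 1 ∨ z = w + 1
  right : ∀ z : ℤ, L ≤ z → S z (z + 1) ∧ ¬ S (z + 1) z
  left : ∀ z : ℤ, z ≤ -L → S z (z - 1) ∧ ¬ S (z - 1) z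

/-- A family of pairwise disjoint copies of the pattern `S` in `D`. -/
structure DisjointFamily {W ι : Type*} (S : ℤ → ℤ → Prop) (D : W → W → Prop) (f : ι → ℤ → W) :
    Prop where
  maps : ∀ i {z w}, S z w → D (f i z) (f i w)
  inj : Function.Injective fun x : ι × ℤ => f x.1 x.2

/-- The `n`-th vertex of the right (`true`) or left (`false`) tail starting at distance `N`. -/
def tailPoint (b : Bool) (N n : ℕ) : ℤ := if b then (N : ℤ) + n else -((N : ℤ) + n)

theorem natAbs_tailPoint (b : Bool) (N n : ℕ) : (tailPoint b N n).natAbs = N + n := by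
  cases b <;> simp [tailPoint] <;> omega

theorem tailPoint_inj {b b' : Bool} {N n n' : ℕ} (hN : 0 < N)
    (h : tailPoint b N n = tailPoint b' N n') : b = b' ∧ n = n' := by
  cases b <;> cases b' <;> simp [tailPoint] at h ⊢ <;> omega

theorem eq_tailPoint {N : ℕ} {z : ℤ} (h : N ≤ z.natAbs) :
    z = tailPoint (decide (0 < z)) N (z.natAbs - N) := by
  by_cases hz : 0 < z <;> simp [tailPoint, hz] <;> omega

section
variable {W ι : Type*} {S : ℤ → ℤ → Prop} {D : W → W → Prop} {L : ℕ} {f : ι → ℤ → W}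

theorem DisjointFamily.eq_of_eq (hf : DisjointFamily S D f) {i i' : ι} {z z' : ℤ}
    (h : f i z = f i' z') : i = i' ∧ z = z' :=
  Prod.ext_iff.1 (@hf.inj (i, z) (i', z') h)

theorem DisjointFamily.comp (hf : DisjointFamily S D f) {κ : Type*} {e : κ → ι}
    (he : Function.Injective e) : DisjointFamily S D fun k => f (e k) where
  maps k := hf.maps (e k)
  inj := fun ⟨k, z⟩ ⟨k', z'⟩ h => by
    obtain ⟨h1, h2⟩ := hf.eq_of_eq h
    exact Prod.ext (he h1) h2

theorem DisjointFamily.tail_injective (hf : DisjointFamily S D f) {N : ℕ} (hN : 0 < N) :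
    Function.Injective fun x : (ι × Bool) × ℕ => f x.1.1 (tailPoint x.1.2 N x.2) := by
  rintro ⟨⟨i, b⟩, n⟩ ⟨⟨i', b'⟩, n'⟩ h
  obtain ⟨h1, h2⟩ := hf.eq_of_eq h
  obtain ⟨h3, h4⟩ := tailPoint_inj hN h2
  simp only at h1 h3 h4
  rw [h1, h3, h4]

theorem DisjointFamily.tail_adj (hf : DisjointFamily S D f) (hS : TwoOutTails S L) {N : ℕ}
    (hN : L ≤ N) (x : ι × Bool) (n : ℕ) :
    D (f x.1 (tailPoint x.2 N n)) (f x.1 (tailPoint x.2 N (n + 1))) := by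
  refine hf.maps x.1 ?_
  cases x.2
  · have := (hS.left (tailPoint false N n) (by simp [tailPoint]; omega)).1
    convert this using 1
    simp [tailPoint]; ring
  · have := (hS.right (tailPoint true N n) (by simp [tailPoint]; omega)).1
    convert this using 1
    simp [tailPoint]; ring

theorem DisjointFamily.snoc {n : ℕ} {f : Fin n → ℤ → W} (hf : DisjointFamily S D f) {g : ℤ → W}
    (hg : ∀ {z w}, S z w → D (g z) (g w)) (hginj : Function.Injective g)
    (hfg : ∀ i z w, f i z ≠ g w) :
    DisjointFamily S D (Fin.snoc (α := fun _ => ℤ → W) f g) where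
  maps i := by
    refine Fin.lastCases ?_ (fun i => ?_) i
    · simpa using hg
    · simpa using hf.maps i
  inj := by
    rintro ⟨i, z⟩ ⟨i', z'⟩
    refine Fin.lastCases ?_ (fun i => ?_) i <;> refine Fin.lastCases ?_ (fun i' => ?_) i' <;>
      intro h <;> simp only [Fin.snoc_last, Fin.snoc_castSucc] at h
    · rw [hginj h]
    · exact absurd h.symm (hfg _ _ _)
    · exact absurd h (hfg _ _ _)
    · obtain ⟨rfl, rfl⟩ := hf.eq_of_eq h
      rfl

/-- An arc of the pattern with an end at distance more than `N` from the origin lies on a tail and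
points outwards. -/
theorem TwoOutTails.far_arc (hS : TwoOutTails S L) {N : ℕ} (hN : L ≤ N) {z w : ℤ} (h : S z w)
    (hfar : ¬ (z.natAbs ≤ N ∧ w.natAbs ≤ N)) :
    ∃ b n, z = tailPoint b N n ∧ w = tailPoint b N (n + 1) := by
  have hL := hS.pos
  rcases hS.near h with rfl | rfl
  · have hz : (N : ℤ) ≤ z := by
      by_contra hlt
      have := (hS.left (z + 1) (by omega)).2
      rw [show z + 1 - 1 = z by ring] at this
      exact this h
    exact ⟨true, z.natAbs - N, by simp [tailPoint]; omega, by simp [tailPoint]; omega⟩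
  · have hw : w + 1 ≤ -(N : ℤ) := by
      by_contra hlt
      exact (hS.right w (by omega)).2 h
    exact ⟨false, (w + 1).natAbs - N, by simp [tailPoint]; omega, by simp [tailPoint]; omega⟩

/-- Given `n` disjoint copies and sufficiently many further disjoint copies that avoid the central
parts of the former, and whose middle parts avoid the former, there are `n + 1` disjoint copies
extending the given central parts. -/
theorem exists_disjointFamily_succ (hS : TwoOutTails S L) {n m N : ℕ} (hN : L ≤ N)
    (hm : 2 * n < m) {f : Fin n → ℤ → W} {g : Fin m → ℤ → W} (hf : DisjointFamily S D f)
    (hg : DisjointFamily S D g) (hcentre : ∀ i z, z.natAbs ≤ N → ∀ s w, f i z ≠ g s w)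
    (hmiddle : ∀ s z, z.natAbs < L → ∀ i w, g s z ≠ f i w) :
    ∃ f' : Fin (n + 1) → ℤ → W, DisjointFamily S D f' ∧
      (∀ (i : Fin n) (z : ℤ), z.natAbs ≤ N → f' i.castSucc z = f i z) ∧
      ∀ i z, (∃ i' z', f' i z = f i' z') ∨ ∃ s w, f' i z = g s w := by
  have hL := hS.pos
  have hN0 : 0 < N := by omega
  obtain ⟨q, hqinj, hqD, hq0, hqmem, hqcard⟩ :=
    exists_ray_exchange (D := D) (Q := fun (x : Fin n × Bool) k => f x.1 (tailPoint x.2 N k))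
      (T := fun (x : Fin m × Bool) k => g x.1 (tailPoint x.2 L k)) (hf.tail_injective hN0) (hg.tail_injective hL)
      (hf.tail_adj hS hN) (hg.tail_adj hS le_rfl)
  have hqeq : ∀ {x x' k k'}, q x k = q x' k' → x = x' ∧ k = k' := fun {x x' k k'} h =>
    Prod.ext_iff.1 (@hqinj (x, k) (x', k') h)
  -- Otherwise one met tail from each new copy gives `m` met tails, but only `2 * n` are allowed.
  obtain ⟨s₀, hs₀⟩ : ∃ s₀ : Fin m, ∀ b x k t, q x k ≠ g s₀ (tailPoint b L t) := by
    by_contra! hcon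
    choose b hb using hcon
    have h1 := hqcard (Finset.univ.image fun s => (s, b s)) (by
      simp only [Finset.mem_image, Finset.mem_univ, true_and]
      rintro _ ⟨s, rfl⟩
      exact hb s)
    rw [Finset.card_image_of_injective _ fun s s' h => (Prod.ext_iff.1 h).1] at h1
    simp at h1
    omega
  let f₀ : Fin n → ℤ → W := fun i z =>
    if z.natAbs ≤ N then f i z else q (i, decide (0 < z)) (z.natAbs - N)
  have hnear : ∀ i z, z.natAbs ≤ N → f₀ i z = f i z := fun i z h => if_pos h
  have hfar : ∀ i z, ¬ z.natAbs ≤ N → f₀ i z = q (i, decide (0 < z)) (z.natAbs - N) :=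
    fun i z h => if_neg h
  have htail : ∀ i b k, f₀ i (tailPoint b N k) = q (i, b) k := by
    intro i b k
    rcases Nat.eq_zero_or_pos k with rfl | hk
    · rw [hnear _ _ (by rw [natAbs_tailPoint]; omega), hq0]
    · have habs := natAbs_tailPoint b N k
      have h1 := eq_tailPoint (N := N) (z := tailPoint b N k) (by omega)
      rw [hfar _ _ (by omega), ← (tailPoint_inj hN0 h1).1, habs, Nat.add_sub_cancel_left]
  -- Past its first vertex a rerouted tail lies on an old tail beyond distance `N` or on a new copy,
  -- and both avoid the centres.
  have hsep : ∀ i z x k, z.natAbs ≤ N → 0 < k → f i z ≠ q x k := by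
    intro i z x k hz hk h
    rcases hqmem x k with h1 | ⟨j, t, h1⟩
    · obtain ⟨-, rfl⟩ := hf.eq_of_eq (h.trans h1)
      rw [natAbs_tailPoint] at hz
      obtain rfl : k = 0 := by omega
      omega
    · exact hcentre i z hz _ _ (h.trans h1)
  have hf₀ : DisjointFamily S D f₀ := by
    refine ⟨fun i z w h => ?_, ?_⟩
    · by_cases hzw : z.natAbs ≤ N ∧ w.natAbs ≤ N
      · rw [hnear _ _ hzw.1, hnear _ _ hzw.2]
        exact hf.maps i h
      · obtain ⟨b, k, rfl, rfl⟩ := hS.far_arc hN h hzw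
        rw [htail, htail]
        exact hqD _ _
    · rintro ⟨i, z⟩ ⟨i', z'⟩ h
      change f₀ i z = f₀ i' z' at h
      by_cases hz : z.natAbs ≤ N <;> by_cases hz' : z'.natAbs ≤ N
      · rw [hnear _ _ hz, hnear _ _ hz'] at h
        exact hf.inj h
      · rw [hnear _ _ hz, hfar _ _ hz'] at h
        exact absurd h (hsep _ _ _ _ hz (by omega))
      · rw [hfar _ _ hz, hnear _ _ hz'] at h
        exact absurd h.symm (hsep _ _ _ _ hz' (by omega))
      · rw [hfar _ _ hz, hfar _ _ hz'] at h
        obtain ⟨h1, h2⟩ := hqeq h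
        obtain ⟨h3, h4⟩ := Prod.ext_iff.1 h1
        simp only at h3 h4
        rw [h3, eq_tailPoint (not_le.1 hz).le, eq_tailPoint (not_le.1 hz').le, h2, h4]
  have hdisj : ∀ i z w, f₀ i z ≠ g s₀ w := by
    intro i z w h
    by_cases hz : z.natAbs ≤ N
    · rw [hnear _ _ hz] at h
      exact hcentre i z hz _ _ h
    · rw [hfar _ _ hz] at h
      by_cases hw : w.natAbs < L
      · rcases hqmem (i, decide (0 < z)) (z.natAbs - N) with h1 | ⟨j, t, h1⟩
        · exact hmiddle s₀ w hw _ _ (h.symm.trans h1)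
        · obtain ⟨-, rfl⟩ := hg.eq_of_eq (h.symm.trans h1)
          rw [natAbs_tailPoint] at hw
          omega
      · rw [eq_tailPoint (not_lt.1 hw)] at h
        exact hs₀ _ _ _ _ h
  refine ⟨_, hf₀.snoc (hg.maps s₀) (fun z w h => (hg.eq_of_eq h).2) hdisj, fun i z hz => ?_,
    fun i z => ?_⟩
  · rw [Fin.snoc_castSucc, hnear _ _ hz]
  · refine Fin.lastCases ?_ (fun i => ?_) i
    · rw [Fin.snoc_last]
      exact Or.inr ⟨s₀, z, rfl⟩
    · rw [Fin.snoc_castSucc]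
      by_cases hz : z.natAbs ≤ N
      · rw [hnear _ _ hz]
        exact Or.inl ⟨i, z, rfl⟩
      · rw [hfar _ _ hz]
        rcases hqmem (i, decide (0 < z)) (z.natAbs - N) with h1 | ⟨j, t, h1⟩
        · exact Or.inl ⟨_, _, h1⟩
        · exact Or.inr ⟨_, _, h1⟩

end
-- Selecting new copies and passing to the limit
section
variable {W : Type*} {S : ℤ → ℤ → Prop} {D : W → W → Prop} {L : ℕ}

/-- From arbitrarily large families of disjoint copies one can pick `m` disjoint copies avoiding a
finite set, each meeting few middle parts, and with middle parts avoiding a given set that meets few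
middle parts. -/
theorem exists_avoiding_family {c : ∀ k : ℕ, Fin k → ℤ → W}
    (hc : ∀ k, DisjointFamily S D (c k)) {Y X : Set W} (hX : X.Finite) {ε δ : ℝ}
    (hε : ε < 1 / 2) (hY : MeetsFewMiddles c L Y ε) (hδ : 0 < δ) (m : ℕ) :
    ∃ g : Fin m → ℤ → W, DisjointFamily S D g ∧ (∀ s z, g s z ∉ X) ∧
      (∀ s (z : ℤ), z.natAbs < L → g s z ∉ Y) ∧
      ∀ s, MeetsFewMiddles c L (Set.range (g s)) δ := by
  classical
  let p : ℝ := ((Finset.Ioo (-(L : ℤ)) L).card : ℕ)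
  -- Unsuitable copies number at most `hX.toFinset.card`, `ε * k < k / 2` and `p / δ` for the three
  -- reasons; this `k` leaves `m` others.
  have hlarge : ∀ᶠ k : ℕ in atTop, 2 * (hX.toFinset.card + p / δ + m) ≤ (k : ℝ) :=
    tendsto_natCast_atTop_atTop.eventually_ge_atTop _
  obtain ⟨k, hk, hkY⟩ := ((hlarge.filter_mono Nat.hyperfilter_le_atTop).and hY).exists
  let B₁ : Finset (Fin k) := Finset.univ.filter fun j => ∃ z, c k j z ∈ X
  let B₂ : Finset (Fin k) :=
    Finset.univ.filter fun j => ∃ z ∈ Finset.Ioo (-(L : ℤ)) L, c k j z ∈ Y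
  let B₃ : Finset (Fin k) :=
    Finset.univ.filter fun j => ¬ MeetsFewMiddles c L (Set.range (c k j)) δ
  have h₁ : B₁.card ≤ hX.toFinset.card := by
    have hex : ∀ j ∈ B₁, ∃ z, c k j z ∈ X := fun j hj => (Finset.mem_filter.1 hj).2
    choose! e he using hex
    refine Finset.card_le_card_of_injOn (fun j => c k j (e j)) (fun j hj => ?_) ?_
    · simpa using he j hj
    · exact fun j _ j' _ h => ((hc k).eq_of_eq h).1
  have h₂ : (B₂.card : ℝ) ≤ ε * k := by
    convert hkY using 2
    unfold middleHits
    congr!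
  have h₃ : (B₃.card : ℝ) ≤ p / δ := by
    rw [le_div_iff₀ hδ]
    refine card_mul_le_of_not_meetsFewMiddles (Y := fun j => Set.range (c k j)) ?_ B₃
      fun j hj => (Finset.mem_filter.1 hj).2
    intro j j' hne
    rw [Set.disjoint_left]
    rintro _ ⟨z, rfl⟩ ⟨z', h⟩
    exact hne ((hc k).eq_of_eq h).1.symm
  let G : Finset (Fin k) := Finset.univ \ (B₁ ∪ B₂ ∪ B₃)
  have hG : m ≤ G.card := by
    have h4 : k ≤ G.card + (B₁ ∪ B₂ ∪ B₃).card := by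
      have := Finset.card_sdiff_add_card_eq_card (Finset.subset_univ (B₁ ∪ B₂ ∪ B₃))
      rw [Finset.card_univ, Fintype.card_fin] at this
      exact this.ge
    have h5 : (B₁ ∪ B₂ ∪ B₃).card ≤ B₁.card + B₂.card + B₃.card :=
      (Finset.card_union_le _ _).trans (Nat.add_le_add_right (Finset.card_union_le _ _) _)
    have h6 : (k : ℝ) ≤ G.card + (B₁.card + B₂.card + B₃.card) := by exact_mod_cast h4.trans (by omega)
    have h7 : (B₁.card : ℝ) ≤ hX.toFinset.card := by exact_mod_cast h₁
    have h8 : ε * k ≤ 1 / 2 * k := mul_le_mul_of_nonneg_right hε.le (Nat.cast_nonneg k)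
    have h9 : (m : ℝ) ≤ G.card := by linarith
    exact_mod_cast h9
  obtain ⟨e⟩ : Nonempty (Fin m ↪ G) :=
    Function.Embedding.nonempty_of_card_le (by simpa using hG)
  have hmem : ∀ s, ((e s : Fin k) ∉ B₁ ∧ (e s : Fin k) ∉ B₂) ∧ (e s : Fin k) ∉ B₃ := by
    intro s
    have := (e s).2
    simp only [G, Finset.mem_sdiff, Finset.mem_union, not_or] at this
    exact this.2
  refine ⟨fun s => c k (e s), (hc k).comp (e := fun s => (e s : Fin k))
    (Subtype.val_injective.comp e.injective), fun s z h => (hmem s).1.1 ?_,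
    fun s z hz h => (hmem s).1.2 ?_, fun s => ?_⟩
  · exact Finset.mem_filter.2 ⟨Finset.mem_univ _, z, h⟩
  · exact Finset.mem_filter.2 ⟨Finset.mem_univ _, z, Finset.mem_Ioo.2 (by omega), h⟩
  · by_contra h
    exact (hmem s).2 (Finset.mem_filter.2 ⟨Finset.mem_univ _, h⟩)

/-- A family of `n` disjoint copies that together meet fewer than half of the middle parts. -/
def ExtendableFamily (S : ℤ → ℤ → Prop) (D : W → W → Prop) (L : ℕ) (c : ∀ k : ℕ, Fin k → ℤ → W)
    {n : ℕ} (f : Fin n → ℤ → W) : Prop :=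
  DisjointFamily S D f ∧ ∃ ε < 1 / 2, MeetsFewMiddles c L (⋃ i, Set.range (f i)) ε

/-- The frozen radius `L + n` grows with `n`, so that each vertex of each copy is eventually fixed.
-/
theorem ExtendableFamily.exists_succ (hS : TwoOutTails S L) {c : ∀ k : ℕ, Fin k → ℤ → W}
    (hc : ∀ k, DisjointFamily S D (c k)) {n : ℕ} {f : Fin n → ℤ → W}
    (hf : ExtendableFamily S D L c f) :
    ∃ f' : Fin (n + 1) → ℤ → W, ExtendableFamily S D L c f' ∧
      ∀ (i : Fin n) (z : ℤ), z.natAbs ≤ L + n → f' i.castSucc z = f i z := by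
  obtain ⟨hfd, ε, hε, hfε⟩ := hf
  have hX : {x | ∃ i z, z.natAbs ≤ L + n ∧ f i z = x}.Finite := by
    have : {x | ∃ i z, z.natAbs ≤ L + n ∧ f i z = x} ⊆
        (fun x : Fin n × ℤ => f x.1 x.2) ''
          (Set.univ ×ˢ Set.Icc (-((L + n : ℕ) : ℤ)) ((L + n : ℕ) : ℤ)) := by
      rintro _ ⟨i, z, hz, rfl⟩
      exact ⟨(i, z), ⟨trivial, by simp only [Set.mem_Icc]; omega⟩, rfl⟩
    exact ((Set.finite_univ.prod (Set.finite_Icc _ _)).image _).subset this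
  obtain ⟨g, hg, hgX, hgY, hgδ⟩ := exists_avoiding_family hc hX hε hfε
    -- The `2 * n + 1` new copies together use up only half of the slack `1 / 2 - ε`.
    (δ := (1 / 2 - ε) / (2 * (2 * n + 1 : ℕ))) (div_pos (by linarith) (by positivity)) (2 * n + 1)
  obtain ⟨f', hf', hagree, hsub⟩ := exists_disjointFamily_succ hS (N := L + n) (by omega)
    (by omega) hfd hg (fun i z hz s w h => hgX s w ⟨i, z, hz, h⟩)
    (fun s z hz i w h => hgY s z hz (Set.mem_iUnion.2 ⟨i, w, h.symm⟩))
  refine ⟨f', ⟨hf', _, ?_, (hfε.union (MeetsFewMiddles.iUnion_fin hgδ)).mono ?_⟩, hagree⟩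
  · have h0 : (0 : ℝ) < ((2 * n + 1 : ℕ) : ℝ) := by positivity
    have : ((2 * n + 1 : ℕ) : ℝ) * ((1 / 2 - ε) / (2 * (2 * n + 1 : ℕ))) = (1 / 2 - ε) / 2 := by
      field_simp
    linarith
  · refine Set.iUnion_subset fun i => ?_
    rintro _ ⟨z, rfl⟩
    rcases hsub i z with ⟨i', z', h⟩ | ⟨s, w, h⟩
    · exact Or.inl (Set.mem_iUnion.2 ⟨i', z', h.symm⟩)
    · exact Or.inr (Set.mem_iUnion.2 ⟨s, w, h.symm⟩)

/-- If there are arbitrarily many disjoint copies of a pattern with two outgoing tails, then there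
are infinitely many. -/
theorem TwoOutTails.exists_infinite_family (hS : TwoOutTails S L)
    (h : ∀ k : ℕ, ∃ c : Fin k → ℤ → W, DisjointFamily S D c) :
    ∃ c : ℕ → ℤ → W, DisjointFamily S D c := by
  choose c hc using h
  have hzero : ExtendableFamily S D L c (Fin.elim0 : Fin 0 → ℤ → W) :=
    ⟨⟨fun i => i.elim0, fun x => x.1.elim0⟩, 0, by norm_num, by
      simpa using meetsFewMiddles_empty⟩
  let F : ∀ n : ℕ, {f : Fin n → ℤ → W // ExtendableFamily S D L c f} := fun n =>
    Nat.rec ⟨_, hzero⟩ (fun _ f => ⟨_, (f.2.exists_succ hS hc).choose_spec.1⟩) n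
  have hF : ∀ n (i : Fin n) (z : ℤ), z.natAbs ≤ L + n →
      (F (n + 1)).1 i.castSucc z = (F n).1 i z := fun n =>
    ((F n).2.exists_succ hS hc).choose_spec.2
  have hstable : ∀ n m (hnm : n ≤ m) (i : ℕ) (hi : i < n) (z : ℤ), z.natAbs ≤ L + n →
      (F m).1 ⟨i, hi.trans_le hnm⟩ z = (F n).1 ⟨i, hi⟩ z := by
    intro n m hnm
    induction m, hnm using Nat.le_induction with
    | base => intros; rfl
    | succ m hnm ih =>
      intro i hi z hz
      rw [← ih i hi z hz]
      exact hF m ⟨i, hi.trans_le hnm⟩ z (by omega)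
  -- Copy `i` exists from stage `i + 1` on, and its vertex `z` no longer changes once the stage also
  -- reaches `z.natAbs`.
  let d : ℕ → ℤ → W := fun i z => (F (i + 1 + z.natAbs)).1 ⟨i, by omega⟩ z
  have hd : ∀ i z n (hi : i < n), i + 1 + z.natAbs ≤ n → d i z = (F n).1 ⟨i, hi⟩ z :=
    fun i z n hi hn => (hstable _ n hn i (by omega) z (by omega)).symm
  refine ⟨d, fun i z w hzw => ?_, ?_⟩
  · rw [hd i z (i + 1 + z.natAbs + w.natAbs) (by omega) (by omega),
      hd i w (i + 1 + z.natAbs + w.natAbs) (by omega) (by omega)]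
    exact (F _).2.1.maps _ hzw
  · rintro ⟨i, z⟩ ⟨i', z'⟩ he
    change d i z = d i' z' at he
    rw [hd i z (i + 1 + z.natAbs + (i' + 1 + z'.natAbs)) (by omega) (by omega),
      hd i' z' (i + 1 + z.natAbs + (i' + 1 + z'.natAbs)) (by omega) (by omega)] at he
    obtain ⟨h1, h2⟩ := (F _).2.1.eq_of_eq he
    exact Prod.ext (Fin.mk.inj_iff.1 h1) h2

end

/-! ### Parity of turns and direction of the tails -/

/-- A set of integers at which a predicate changes its value has odd size on an interval iff the
predicate takes different values at the two ends. -/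
theorem odd_card_changes_iff (d : ℤ → Prop) [DecidablePred fun z => ¬ (d (z - 1) ↔ d z)] (a : ℤ)
    (m : ℕ) : Odd ((Finset.Ioc a (a + m)).filter fun z => ¬ (d (z - 1) ↔ d z)).card ↔
      ¬ (d a ↔ d (a + m)) := by
  induction m with
  | zero => simp
  | succ m ih =>
    have h1 : Finset.Ioc a (a + (m + 1 : ℕ)) = insert (a + m + 1) (Finset.Ioc a (a + m)) := by
      ext z
      simp only [Finset.mem_Ioc, Finset.mem_insert]
      omega
    have h2 : a + ((m + 1 : ℕ) : ℤ) = a + m + 1 := by push_cast; ring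
    rw [h1, Finset.filter_insert, h2]
    by_cases h : d (a + m + 1 - 1) ↔ d (a + m + 1)
    · rw [if_neg (not_not.2 h), ih]
      rw [add_sub_cancel_right] at h
      rw [h]
    · rw [if_pos h, Finset.card_insert_of_notMem (by simp), Nat.odd_add_one, ih]
      rw [add_sub_cancel_right] at h
      tauto

/-- An orientation of the double ray on `ℤ` with a finite odd number of changes of direction has its
two tails both directed away from the origin, or both directed towards it. -/
theorem exists_twoOutTails {S : ℤ → ℤ → Prop} (hnear : ∀ {z w}, S z w → w = z + 1 ∨ z = w + 1)
    (hone : ∀ z, S (z + 1) z ↔ ¬ S z (z + 1))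
    (hfin : {z | ¬ (S (z - 1) z ↔ S z (z + 1))}.Finite)
    (hodd : Odd {z | ¬ (S (z - 1) z ↔ S z (z + 1))}.ncard) :
    ∃ L, TwoOutTails S L ∨ TwoOutTails (fun z w => S w z) L := by
  classical
  let d : ℤ → Prop := fun z => S z (z + 1)
  have hd : ∀ z, S (z - 1) z ↔ d (z - 1) := fun z => by simp [d]
  have hone' : ∀ z, S z (z - 1) ↔ ¬ d (z - 1) := fun z => by
    have := hone (z - 1)
    rwa [sub_add_cancel, hd] at this
  have hset : {z | ¬ (S (z - 1) z ↔ S z (z + 1))} = {z | ¬ (d (z - 1) ↔ d z)} := by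
    ext z
    simp only [Set.mem_ofPred_eq, hd]
    rfl
  rw [hset] at hfin hodd
  obtain ⟨b, hb⟩ := (hfin.image Int.natAbs).bddAbove
  have hb' : ∀ z : ℤ, b < z.natAbs → (d (z - 1) ↔ d z) := by
    intro z hz
    by_contra h
    exact absurd (hb ⟨z, h, rfl⟩) (by omega)
  -- All changes of direction lie in this interval and their number is odd, so the two tails run
  -- oppositely along `ℤ`.
  have hdiff : ¬ (d (-((b + 1 : ℕ) : ℤ)) ↔ d ((b + 1 : ℕ) : ℤ)) := by
    have h1 := odd_card_changes_iff d (-((b + 1 : ℕ) : ℤ)) (2 * (b + 1))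
    rw [show -((b + 1 : ℕ) : ℤ) + ((2 * (b + 1) : ℕ) : ℤ) = ((b + 1 : ℕ) : ℤ) by
      push_cast; ring] at h1
    rw [← h1, ← Set.ncard_coe_finset]
    convert hodd using 2
    ext z
    simp only [Finset.coe_filter, Finset.mem_Ioc, Set.mem_ofPred_eq, and_iff_right_iff_imp]
    intro h
    have : ¬ b < z.natAbs := fun hlt => h (hb' z hlt)
    omega
  have hright : ∀ z : ℤ, ((b + 1 : ℕ) : ℤ) ≤ z → (d z ↔ d ((b + 1 : ℕ) : ℤ)) := by
    intro z hz
    induction z, hz using Int.leInduction with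
    | base => rfl
    | succ z hz ih =>
      have := hb' (z + 1) (by omega)
      rw [add_sub_cancel_right] at this
      rw [← this, ih]
  have hleft : ∀ z : ℤ, z ≤ -((b + 1 : ℕ) : ℤ) → (d (z - 1) ↔ d (-((b + 1 : ℕ) : ℤ))) := by
    intro z hz
    induction z, hz using Int.leInductionDown with
    | base => exact hb' _ (by omega)
    | pred z hz ih => rw [hb' (z - 1) (by omega), ih]
  refine ⟨b + 1, ?_⟩
  by_cases h : d ((b + 1 : ℕ) : ℤ)
  · have h' : ¬ d (-((b + 1 : ℕ) : ℤ)) := by tauto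
    refine Or.inl ⟨by omega, hnear, fun z hz => ?_, fun z hz => ?_⟩
    · have := (hright z hz).2 h
      exact ⟨this, fun h2 => (hone z).1 h2 this⟩
    · have := mt (hleft z hz).1 h'
      exact ⟨(hone' z).2 this, fun h2 => this ((hd z).1 h2)⟩
  · have h' : d (-((b + 1 : ℕ) : ℤ)) := by tauto
    refine Or.inr ⟨by omega, fun h => (hnear h).symm, fun z hz => ?_, fun z hz => ?_⟩
    · have := mt (hright z hz).1 h
      exact ⟨(hone z).2 this, this⟩
    · have := (hleft z hz).2 h'
      exact ⟨(hd z).2 this, fun h2 => (hone' z).1 h2 this⟩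

/-! ### Transfer to `ℤ` and conclusion -/

theorem theorem4p4 {V : Type u} [LinearOrder V] (R : Digraph V) (hR : IsDoubleRay R)
    (hfin : {t : V | IsTurn R t}.Finite) (hodd : Odd {t : V | IsTurn R t}.ncard) :
    Ubiquitous.{u, v} R := by
  obtain ⟨e⟩ := hR.orderIso_int
  let S : ℤ → ℤ → Prop := fun z w => R.Adj (e.symm z) (e.symm w)
  have hcov : ∀ z w : ℤ, e.symm z ⋖ e.symm w ↔ w = z + 1 := fun z w => by
    rw [apply_covBy_apply_iff, Order.covBy_iff_add_one_eq, eq_comm]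
  have hnear : ∀ {z w}, S z w → w = z + 1 ∨ z = w + 1 := by
    intro z w h
    by_contra! hne
    exact hR.not_adj_of_not_consecutive _ _ (mt (hcov z w).1 hne.1) (mt (hcov w z).1 hne.2) h
  have hone : ∀ z, S (z + 1) z ↔ ¬ S z (z + 1) := by
    intro z
    have := hR.adj_of_consecutive _ _ ((hcov z (z + 1)).2 rfl)
    change (S z (z + 1) ∧ ¬ S (z + 1) z) ∨ (S (z + 1) z ∧ ¬ S z (z + 1)) at this
    tauto
  -- Turns are exactly the points where the two neighbouring arcs run in opposite directions along
  -- `ℤ`.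
  have hturn : e '' {t : V | IsTurn R t} = {z | ¬ (S (z - 1) z ↔ S z (z + 1))} := by
    ext z
    have hone' := hone (z - 1)
    rw [sub_add_cancel] at hone'
    have hSe : ∀ a b : V, R.Adj a b ↔ S (e a) (e b) := fun a b => by simp [S]
    constructor
    · rintro ⟨t, ht, rfl⟩
      have hne : ∀ {a b : V}, a ≠ b → e a ≠ e b := fun h => e.injective.ne h
      rcases ht with ⟨a, b, hab, h1, h2⟩ | ⟨a, b, hab, h1, h2⟩ <;> rw [hSe] at h1 h2 <;>
        have hab := hne hab <;> generalize e t = z at * <;> generalize e a = x at * <;>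
        generalize e b = y at *
      all_goals
        have h3 : (x = z + 1 ∧ y = z - 1) ∨ (x = z - 1 ∧ y = z + 1) := by
          have := hnear h1
          have := hnear h2
          omega
        have := hone z
        simp only [Set.mem_ofPred_eq]
        rcases h3 with ⟨rfl, rfl⟩ | ⟨rfl, rfl⟩ <;> tauto
    · intro h
      refine ⟨e.symm z, ?_, by simp⟩
      have hne : e.symm (z - 1) ≠ e.symm (z + 1) := e.symm.injective.ne (by omega)
      by_cases h1 : S z (z + 1)
      · exact Or.inl ⟨_, _, hne, hone'.2 fun h2 => h (iff_of_true h2 h1), h1⟩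
      · refine Or.inr ⟨_, _, hne, ?_, (hone z).2 h1⟩
        by_contra h2
        exact h (iff_of_false h2 h1)
  obtain ⟨L, hL⟩ := exists_twoOutTails hnear hone (hturn ▸ hfin.image e)
    (by rwa [← hturn, Set.ncard_image_of_injective _ e.injective])
  intro W D hD
  have hfam : ∀ k : ℕ, ∃ c : Fin k → ℤ → W, DisjointFamily S D.Adj c := by
    intro k
    obtain ⟨c, hc⟩ := hD k
    refine ⟨fun i z => (c i).toFun (e.symm z), fun i z w h => (c i).map_adj h, ?_⟩
    rintro ⟨i, z⟩ ⟨j, w⟩ h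
    change (c i).toFun (e.symm z) = (c j).toFun (e.symm w) at h
    by_cases hij : i = j
    · subst hij
      rw [e.symm.injective ((c i).injective h)]
    · exact absurd ⟨_, h.symm⟩ (Set.disjoint_left.1 (hc hij) ⟨_, rfl⟩)
  have hinf : ∃ c : ℕ → ℤ → W, DisjointFamily S D.Adj c := by
    rcases hL with hL | hL
    · exact hL.exists_infinite_family hfam
    -- Inward tails become outward when all arcs of pattern and host are reversed; the copies are
    -- the same.
    · obtain ⟨c, hc⟩ := hL.exists_infinite_family (D := fun a b => D.Adj b a) fun k => by
        obtain ⟨c, hc⟩ := hfam k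
        exact ⟨c, fun i _ _ h => hc.maps i h, hc.inj⟩
      exact ⟨c, fun i _ _ h => hc.maps i h, hc.inj⟩
  obtain ⟨c, hc⟩ := hinf
  refine ⟨fun i => ⟨fun x => c i (e x), fun x y h => e.injective (hc.eq_of_eq h).2,
    fun {x y} h => hc.maps i (by simpa [S] using h)⟩, fun i j hij => ?_⟩
  refine Set.disjoint_left.2 ?_
  rintro _ ⟨x, rfl⟩ ⟨y, h⟩
  exact hij (hc.eq_of_eq h).1.symm
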